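/- Let $(M,\omega)$ be a symplectic manifold, i.e. a smooth finite-dimensional manifold without boundary (Hausdorff and $\sigma$-compact, possibly non-compact and possibly disconnected) with a smooth, closed, nondegenerate $2$-form $\omega$. For $F,G\in C^\infty_c(M)$ (smooth real functions with compact support) let $\{F,G\}=dF(X_G)$ be the Poisson bracket, where $X_G$ is the vector field determined by $\omega(X_G,\cdot)=-dG$, and let $\|\cdot\|$ be the supremum norm. For compact sets $X,Y,Z\subseteq M$ put \[ \mathrm{pb}_3(X,Y,Z):=\inf\left\{\|\{F,G\}\| \;\middle|\; F,G\in C^\infty_c(M),\ F|_X\le 0,\ G|_Y\le 0,\ (F+G)|_Z\ge 1\right\}, \] and for compact sets $X_0,X_1,Y_0,Y_1\subseteq M$ put \[ \mathrm{pb}_4(X_0,X_1,Y_0,Y_1):=\inf\left\{\|\{F,G\}\| \;\middle|\; F,G\in C^\infty_c(M),\ F|_{X_0}\le 0,\ F|_{X_1}\ge 1,\ G|_{Y_0}\le 0,\ G|_{Y_1}\ge 1\right\}. \] Let $X_0,X_1,Y_0,Y_1\subseteq M$ be compact sets with $X_0\cap X_1=Y_0\cap Y_1=\emptyset$. Then \[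 \mathrm{pb}_4(X_0,X_1,Y_0,Y_1)=2\cdot\mathrm{pb}_3(X_0,Y_0,X_1\cup Y_1). \] -/

import Mathlib

open scoped Manifold ContDiff ENNReal

noncomputable section

namespace PoissonBracketInvariants

variable {E : Type*} [NormedAddCommGroup E] [NormedSpace ℝ E]
  {M : Type*} [TopologicalSpace M] [ChartedSpace E M]

/-- The expression of a (pointwise given) 2-form `Ω` on `M` in the preferred chart around `x₀`:
the pullback of `Ω` by the inverse of the chart, a 2-form on the target of the chart in `E`. -/
def chartForm (Ω : ∀ x : M, TangentSpace 𝓘(ℝ, E) x [⋀^Fin 2]→L[ℝ] ℝ) (x₀ : M) :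
    E → E [⋀^Fin 2]→L[ℝ] ℝ := fun y =>
  (Ω ((extChartAt 𝓘(ℝ, E) x₀).symm y)).compContinuousLinearMap
    (mfderiv 𝓘(ℝ, E) 𝓘(ℝ, E) (extChartAt 𝓘(ℝ, E) x₀).symm y)

variable (E M) in
/-- A symplectic form on the manifold `M` (without boundary, modelled on `E`): a smooth closed
nondegenerate differential 2-form. Smoothness and closedness are expressed in charts, with the
exterior derivative of forms on `E`. -/
structure SymplecticForm where
  /-- the alternating bilinear form on each tangent space -/
  form : ∀ x : M, TangentSpace 𝓘(ℝ, E) x [⋀^Fin 2]→L[ℝ] ℝ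
  smooth : ∀ x₀ : M, ContDiffOn ℝ ∞ (chartForm form x₀) (extChartAt 𝓘(ℝ, E) x₀).target
  closed : ∀ x₀ : M, ∀ y ∈ (extChartAt 𝓘(ℝ, E) x₀).target, extDeriv (chartForm form x₀) y = 0
  nondegenerate : ∀ (x : M) (v : TangentSpace 𝓘(ℝ, E) x), (∀ w, form x ![v, w] = 0) → v = 0

/-- The differential of a real function at `x`, as an element of the dual of the tangent space. -/
def differential (F : M → ℝ) (x : M) : Module.Dual ℝ (TangentSpace 𝓘(ℝ, E) x) :=
  (mfderiv 𝓘(ℝ, E) 𝓘(ℝ, ℝ) F x).toLinearMap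

namespace SymplecticForm

variable (Ω : SymplecticForm E M)

/-- The linear map `v ↦ Ω(v, ·)` from the tangent space at `x` to its dual. -/
def flat (x : M) : TangentSpace 𝓘(ℝ, E) x →ₗ[ℝ] Module.Dual ℝ (TangentSpace 𝓘(ℝ, E) x) :=
  LinearMap.mk₂ ℝ (fun v w => Ω.form x ![v, w])
    (fun v v' w => by
      simpa using (Ω.form x).toMultilinearMap.cons_add ![w] v v')
    (fun c v w => by
      simpa using (Ω.form x).toMultilinearMap.cons_smul ![w] c v)
    (fun v w w' => by
      have h : ∀ z, Function.update ![v, w] 1 z = ![v, z] := fun z => by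
        ext i; fin_cases i <;> rfl
      simpa only [h] using (Ω.form x).map_update_add ![v, w] 1 w w')
    (fun c v w => by
      have h : ∀ z, Function.update ![v, w] 1 z = ![v, z] := fun z => by
        ext i; fin_cases i <;> rfl
      simpa only [h] using (Ω.form x).map_update_smul ![v, w] 1 c w)

@[simp]
theorem flat_apply (x : M) (v w : TangentSpace 𝓘(ℝ, E) x) :
    Ω.flat x v w = Ω.form x ![v, w] := rfl

theorem flat_injective (x : M) : Function.Injective (Ω.flat x) := by
  rw [injective_iff_map_eq_zero]
  intro v hv
  exact Ω.nondegenerate x v fun w => by rw [← flat_apply, hv]; rfl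

variable [FiniteDimensional ℝ E]

/-- The isomorphism `v ↦ Ω(v, ·)` from the tangent space at `x` to its dual. -/
def flatEquiv (x : M) : TangentSpace 𝓘(ℝ, E) x ≃ₗ[ℝ] Module.Dual ℝ (TangentSpace 𝓘(ℝ, E) x) :=
  haveI : FiniteDimensional ℝ (TangentSpace 𝓘(ℝ, E) x) := inferInstanceAs (FiniteDimensional ℝ E)
  LinearMap.linearEquivOfInjective (Ω.flat x) (Ω.flat_injective x) Subspace.dual_finrank_eq.symm

/-- The Hamiltonian vector field `X_F` of `F`, determined by `Ω(X_F, ·) = -dF`. -/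
def hamiltonianField (F : M → ℝ) (x : M) : TangentSpace 𝓘(ℝ, E) x :=
  (Ω.flatEquiv x).symm (-differential F x)

/-- The defining property of the Hamiltonian vector field. -/
theorem form_hamiltonianField (F : M → ℝ) (x : M) (w : TangentSpace 𝓘(ℝ, E) x) :
    Ω.form x ![Ω.hamiltonianField F x, w] = -differential F x w := by
  have h := LinearEquiv.apply_symm_apply (Ω.flatEquiv x) (-differential F x)
  exact congrArg (fun l : Module.Dual ℝ (TangentSpace 𝓘(ℝ, E) x) => l w) h

/-- The Poisson bracket `{F, G} = dF(X_G) = Ω(X_G, X_F)`. -/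
def poissonBracket (F G : M → ℝ) (x : M) : ℝ :=
  differential F x (Ω.hamiltonianField G x)

end SymplecticForm

/-- The supremum norm of a real function, with values in `[0, ∞]`. -/
def supNorm {α : Type*} (f : α → ℝ) : ℝ≥0∞ := ⨆ x, ‖f x‖ₑ

variable (E) in
/-- `F` is a smooth real function with compact support on `M`. -/
def IsSmoothCompactSupport (F : M → ℝ) : Prop :=
  ContMDiff 𝓘(ℝ, E) 𝓘(ℝ, ℝ) ∞ F ∧ HasCompactSupport F

variable [FiniteDimensional ℝ E]

/-- The Poisson bracket invariant of a triple of sets. -/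
def pb₃ (Ω : SymplecticForm E M) (X Y Z : Set M) : ℝ≥0∞ :=
  sInf {c | ∃ F G : M → ℝ, IsSmoothCompactSupport E F ∧ IsSmoothCompactSupport E G ∧
    (∀ x ∈ X, F x ≤ 0) ∧ (∀ x ∈ Y, G x ≤ 0) ∧ (∀ x ∈ Z, 1 ≤ F x + G x) ∧
    c = supNorm (Ω.poissonBracket F G)}

/-- The Poisson bracket invariant of a quadruple of sets. -/
def pb₄ (Ω : SymplecticForm E M) (X₀ X₁ Y₀ Y₁ : Set M) : ℝ≥0∞ :=
  sInf {c | ∃ F G : M → ℝ, IsSmoothCompactSupport E F ∧ IsSmoothCompactSupport E G ∧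
    (∀ x ∈ X₀, F x ≤ 0) ∧ (∀ x ∈ X₁, 1 ≤ F x) ∧
    (∀ x ∈ Y₀, G x ≤ 0) ∧ (∀ x ∈ Y₁, 1 ≤ G x) ∧
    c = supNorm (Ω.poissonBracket F G)}

end PoissonBracketInvariants

end

open Set Filter Topology
open scoped Manifold ContDiff ENNReal

namespace PoissonBracketInvariants

/-! A change of functions `(F, G) ↦ Φ(F, G)` multiplies the bracket pointwise by the Jacobian of `Φ`
(`poissonBracket_eq_det_mul`), so each inequality needs a planar map with the right Jacobian that
carries one kind of constraint to the other.

For `2 * pb₃ ≤ pb₄`, take positive parts `x`, `y` and subtract `min x y / 2` from each. The sum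
becomes `max x y`, which is at least `1` on `X₁ ∪ Y₁`. The Jacobian is `1/2`.

For `pb₄ ≤ 2 * pb₃`, add `min u v` to both functions. The Jacobian is `2`, and the larger of the new
functions `P`, `Q` is `u + v`, so at each point of `X₁ ∪ Y₁` one of them is at least `1`, though
perhaps the wrong one. Clipping makes a function constant where it is near or above `1`. Where only
`Q` is large, the clipped `Q` has zero differential, so a cutoff can be added to `P` on `X₁` without
creating bracket; disjointness from `X₀` lets the cutoff vanish there. The roles of `P` and `Q` are
then exchanged for `Y₁`.

Smoothing `min` costs multiples of `ε`, absorbed by a factor `c⁻¹` on each function with `c → 1`. -/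

/-! ### A smooth approximation of the positive part -/

/-- A smooth approximation from below, up to `ε`, of the positive part of a real number. -/
noncomputable def smoothPosPart (ε t : ℝ) : ℝ := t * expNegInvGlue (t / ε)

section smoothPosPart

variable {ε t : ℝ}

theorem contDiff_smoothPosPart (ε : ℝ) : ContDiff ℝ ∞ (smoothPosPart ε) :=
  contDiff_id.mul (expNegInvGlue.contDiff.comp (contDiff_id.div_const ε))

theorem smoothPosPart_of_pos (hε : 0 < ε) (ht : 0 < t) :
    smoothPosPart ε t = t * Real.exp (-(ε / t)) := by
  have h : ¬ t / ε ≤ 0 := not_le.2 (div_pos ht hε)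
  simp [smoothPosPart, expNegInvGlue, h]

theorem smoothPosPart_of_nonpos (hε : 0 < ε) (ht : t ≤ 0) : smoothPosPart ε t = 0 := by
  rw [smoothPosPart, expNegInvGlue.zero_of_nonpos (div_nonpos_of_nonpos_of_nonneg ht hε.le),
    mul_zero]

theorem smoothPosPart_nonneg (hε : 0 < ε) (t : ℝ) : 0 ≤ smoothPosPart ε t := by
  rcases le_or_gt t 0 with ht | ht
  · exact (smoothPosPart_of_nonpos hε ht).ge
  · exact mul_nonneg ht.le (expNegInvGlue.nonneg _)

theorem smoothPosPart_le (hε : 0 < ε) (ht : 0 ≤ t) : smoothPosPart ε t ≤ t := by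
  rcases ht.eq_or_lt with rfl | ht
  · exact (smoothPosPart_of_nonpos hε le_rfl).le
  · rw [smoothPosPart_of_pos hε ht]
    exact mul_le_of_le_one_right ht.le (Real.exp_le_one_iff.2 (by simpa using (div_pos hε ht).le))

theorem sub_le_smoothPosPart (hε : 0 < ε) (t : ℝ) : t - ε ≤ smoothPosPart ε t := by
  rcases le_or_gt t 0 with ht | ht
  · rw [smoothPosPart_of_nonpos hε ht]
    linarith
  · rw [smoothPosPart_of_pos hε ht]
    calc t - ε = t * (-(ε / t) + 1) := by field_simp; ring
      _ ≤ _ := mul_le_mul_of_nonneg_left (Real.add_one_le_exp _) ht.le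

/-- For `t > 0` and `s = ε / t` the slope is `exp (-s) * (1 + s)`, at most `1` because `1 + s ≤ exp
s`. For `t ≤ 0` the function is at its minimum. -/
theorem exists_hasDerivAt_smoothPosPart (hε : 0 < ε) (t : ℝ) :
    ∃ k ∈ Icc (0 : ℝ) 1, HasDerivAt (smoothPosPart ε) k t := by
  rcases le_or_gt t 0 with ht | ht
  · refine ⟨0, by simp, ?_⟩
    have hd := ((contDiff_smoothPosPart ε).differentiable (by simp) t).hasDerivAt
    have hmin : IsLocalMin (smoothPosPart ε) t := Eventually.of_forall fun y => by
      rw [smoothPosPart_of_nonpos hε ht]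
      exact smoothPosPart_nonneg hε y
    rwa [hmin.hasDerivAt_eq_zero hd] at hd
  · refine ⟨Real.exp (-(ε / t)) * (ε / t + 1), ⟨by positivity, ?_⟩, ?_⟩
    · calc Real.exp (-(ε / t)) * (ε / t + 1) ≤ Real.exp (-(ε / t)) * Real.exp (ε / t) :=
            mul_le_mul_of_nonneg_left (Real.add_one_le_exp _) (Real.exp_pos _).le
        _ = 1 := by rw [← Real.exp_add, neg_add_cancel, Real.exp_zero]
    · have h := (hasDerivAt_id t).mul (((hasDerivAt_inv ht.ne').const_mul ε).neg.exp)
      refine (h.congr_of_eventuallyEq ?_).congr_deriv ?_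
      · filter_upwards [lt_mem_nhds ht] with y hy
        simp [smoothPosPart_of_pos hε hy, div_eq_mul_inv]
      · simp only [id, Pi.neg_apply, div_eq_mul_inv]
        field_simp
        ring

theorem monotone_smoothPosPart (hε : 0 < ε) : Monotone (smoothPosPart ε) := by
  refine monotone_of_deriv_nonneg ((contDiff_smoothPosPart ε).differentiable (by simp)) fun t => ?_
  obtain ⟨k, hk, h⟩ := exists_hasDerivAt_smoothPosPart hε t
  exact h.deriv ▸ hk.1

/-- Existence of smooth nonexpanding clipping functions. -/
theorem exists_smooth_clip (hε : 0 < ε) (b : ℝ) :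
    ∃ (ρ : ℝ → ℝ) (C : ℝ), ContDiff ℝ ∞ ρ ∧ (∀ t ≤ ε, ρ t = 0) ∧ (∀ t, 0 ≤ ρ t) ∧
      (∀ t, b ≤ t → ρ t = C) ∧ b - 3 * ε ≤ C ∧
      ∀ t, ∃ k ∈ Icc (0 : ℝ) 1, HasDerivAt ρ k t := by
  set χ := smoothPosPart ε
  set D := χ (b - ε)
  have hsm := contDiff_smoothPosPart ε
  -- This smooths `min D s = D - (D - s)⁺` with `s = (t - ε)⁺`; the constant `χ D` replaces `D` so
  -- that the value is exactly `0` when `s = 0`.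
  refine ⟨fun t => χ D - χ (D - χ (t - ε)), χ D, ?_, fun t ht => ?_, fun t => ?_, fun t ht => ?_,
    ?_, fun t => ?_⟩
  · exact contDiff_const.sub
      (hsm.comp (contDiff_const.sub (hsm.comp (contDiff_id.sub contDiff_const))))
  · have h : χ (t - ε) = 0 := smoothPosPart_of_nonpos hε (by linarith)
    simp [h]
  · have h := smoothPosPart_nonneg hε (t - ε)
    exact sub_nonneg.2 (monotone_smoothPosPart hε (by linarith))
  · have h : D ≤ χ (t - ε) := monotone_smoothPosPart hε (by linarith)
    have h' : χ (D - χ (t - ε)) = 0 := smoothPosPart_of_nonpos hε (by linarith)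
    simp [h']
  · have h₁ := sub_le_smoothPosPart hε (b - ε)
    have h₂ := sub_le_smoothPosPart hε D
    linarith
  · obtain ⟨k, hk, h⟩ := exists_hasDerivAt_smoothPosPart hε (t - ε)
    obtain ⟨l, hl, h'⟩ := exists_hasDerivAt_smoothPosPart hε (D - χ (t - ε))
    refine ⟨l * k, ⟨mul_nonneg hl.1 hk.1, mul_le_one₀ hl.2 hk.1 hk.2⟩, ?_⟩
    have h₁ : HasDerivAt (fun t => χ (t - ε)) k t := h.comp_sub_const t ε
    have h₂ : HasDerivAt (fun t => χ (D - χ (t - ε))) (l * -k) t :=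
      HasDerivAt.comp (h₂ := χ) t h' (h₁.const_sub D)
    exact (h₂.const_sub (χ D)).congr_deriv (by ring)

end smoothPosPart

/-! ### Smooth functions with compact support and their differentials -/

section functions

variable {E : Type*} [NormedAddCommGroup E] [NormedSpace ℝ E]
  {M : Type*} [TopologicalSpace M] [ChartedSpace E M] {F G : M → ℝ} {ρ : ℝ → ℝ}

theorem IsSmoothCompactSupport.mdifferentiableAt (hF : IsSmoothCompactSupport E F) (x : M) :
    MDifferentiableAt 𝓘(ℝ, E) 𝓘(ℝ, ℝ) F x :=
  hF.1.mdifferentiable (by simp) x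

theorem IsSmoothCompactSupport.comp (hF : IsSmoothCompactSupport E F) (hρ : ContDiff ℝ ∞ ρ)
    (h0 : ρ 0 = 0) : IsSmoothCompactSupport E fun x => ρ (F x) :=
  ⟨hρ.contMDiff.comp hF.1, hF.2.comp_left h0⟩

theorem IsSmoothCompactSupport.linearComb (hF : IsSmoothCompactSupport E F)
    (hG : IsSmoothCompactSupport E G) (a b : ℝ) :
    IsSmoothCompactSupport E fun x => a * F x + b * G x :=
  ⟨(contMDiff_const.mul hF.1).add (contMDiff_const.mul hG.1), hF.2.mul_left.add hG.2.mul_left⟩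

theorem differential_comp {x : M} {k : ℝ} (hF : IsSmoothCompactSupport E F)
    (hρ : HasDerivAt ρ k (F x)) :
    (differential (fun x => ρ (F x)) x : Module.Dual ℝ (TangentSpace 𝓘(ℝ, E) x)) =
      k • differential F x := by
  have h := (hρ.hasFDerivAt.hasMFDerivAt.comp x (hF.mdifferentiableAt x).hasMFDerivAt).mfderiv
  ext v
  simp only [differential]
  change mfderiv 𝓘(ℝ, E) 𝓘(ℝ, ℝ) (ρ ∘ F) x v = _
  rw [h]
  exact mul_comm (G := ℝ) _ _

theorem differential_linearComb (hF : IsSmoothCompactSupport E F)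
    (hG : IsSmoothCompactSupport E G) (a b : ℝ) (x : M) :
    (differential (fun x => a * F x + b * G x) x : Module.Dual ℝ (TangentSpace 𝓘(ℝ, E) x)) =
      a • differential F x + b • differential G x := by
  have h := (((hF.mdifferentiableAt x).hasMFDerivAt.const_smul a).add
    ((hG.mdifferentiableAt x).hasMFDerivAt.const_smul b)).mfderiv
  ext v
  simp only [differential]
  change mfderiv 𝓘(ℝ, E) 𝓘(ℝ, ℝ) (a • F + b • G) x v = _
  rw [h]
  rfl

theorem differential_eq_zero_of_eventually_eq {x : M} {c : ℝ} (h : ∀ᶠ y in 𝓝 x, F y = c) :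
    (differential F x : Module.Dual ℝ (TangentSpace 𝓘(ℝ, E) x)) = 0 := by
  have h' : F =ᶠ[𝓝 x] fun _ => c := h
  rw [differential, h'.mfderiv_eq, mfderiv_const]
  rfl

variable [FiniteDimensional ℝ E]

/-- Existence of smooth compactly supported cutoff functions. -/
theorem exists_cutoff [IsManifold 𝓘(ℝ, E) ∞ M] [T2Space M] [SigmaCompactSpace M] {K U : Set M}
    (hK : IsCompact K) (hU : IsOpen U) (hKU : K ⊆ U) :
    ∃ f : M → ℝ, IsSmoothCompactSupport E f ∧ (∀ x, 0 ≤ f x) ∧ (∀ x ∈ K, f x = 1) ∧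
      tsupport f ⊆ U := by
  have : LocallyCompactSpace M := Manifold.locallyCompact_of_finiteDimensional 𝓘(ℝ, E)
  obtain ⟨L, hL, hKL, hLU⟩ := exists_compact_between hK hU hKU
  obtain ⟨f, hf0, hf1, hf⟩ := exists_contMDiffMap_zero_one_of_isClosed 𝓘(ℝ, E) (n := (⊤ : ℕ∞))
    isOpen_interior.isClosed_compl hK.isClosed (disjoint_compl_left_iff_subset.2 hKL)
  have h0 : ∀ x ∉ L, f x = 0 := fun x hx => hf0 fun h => hx (interior_subset h)
  refine ⟨f, ⟨f.contMDiff, HasCompactSupport.intro hL h0⟩, fun x => (hf x).1, hf1, ?_⟩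
  exact (closure_minimal (Function.support_subset_iff'.2 h0) hL.isClosed).trans hLU

namespace SymplecticForm

variable (Ω : SymplecticForm E M) {x : M}

theorem differential_hamiltonianField_self (F : M → ℝ) (x : M) :
    differential F x (Ω.hamiltonianField F x) = 0 := by
  have h := Ω.form_hamiltonianField F x (Ω.hamiltonianField F x)
  have h' : Ω.form x ![Ω.hamiltonianField F x, Ω.hamiltonianField F x] = 0 :=
    (Ω.form x).map_eq_zero_of_eq _ (i := 0) (j := 1) rfl (by decide)
  linarith

theorem poissonBracket_antisymm (F G : M → ℝ) (x : M) :
    Ω.poissonBracket G F x = -Ω.poissonBracket F G x := by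
  have h₁ := Ω.form_hamiltonianField F x (Ω.hamiltonianField G x)
  have h₂ := Ω.form_hamiltonianField G x (Ω.hamiltonianField F x)
  have h₃ := (Ω.form x).toAlternatingMap.map_swap
    ![Ω.hamiltonianField G x, Ω.hamiltonianField F x] (i := 0) (j := 1) (by decide)
  have h₄ : (![Ω.hamiltonianField G x, Ω.hamiltonianField F x] ∘ Equiv.swap (0 : Fin 2) 1) =
      ![Ω.hamiltonianField F x, Ω.hamiltonianField G x] := by
    ext i; fin_cases i <;> rfl
  rw [h₄] at h₃
  replace h₃ : Ω.form x ![Ω.hamiltonianField F x, Ω.hamiltonianField G x] =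
    -Ω.form x ![Ω.hamiltonianField G x, Ω.hamiltonianField F x] := h₃
  simp only [poissonBracket]
  linarith

/-- The Poisson bracket is multiplied by the Jacobian determinant under a change of functions. -/
theorem poissonBracket_eq_det_mul {F' G' : M → ℝ} {p q r s : ℝ}
    (hF : (differential F' x : Module.Dual ℝ (TangentSpace 𝓘(ℝ, E) x)) =
      p • differential F x + q • differential G x)
    (hG : (differential G' x : Module.Dual ℝ (TangentSpace 𝓘(ℝ, E) x)) =
      r • differential F x + s • differential G x) :
    Ω.poissonBracket F' G' x = (p * s - q * r) * Ω.poissonBracket F G x := by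
  have hX : Ω.hamiltonianField G' x =
      r • Ω.hamiltonianField F x + s • Ω.hamiltonianField G x := by
    simp only [hamiltonianField, hG, neg_add, map_add, map_neg, map_smul, smul_neg]
  have h := Ω.poissonBracket_antisymm F G x
  have hFF := Ω.differential_hamiltonianField_self F x
  have hGG := Ω.differential_hamiltonianField_self G x
  simp only [poissonBracket] at h ⊢
  rw [hF, hX]
  simp only [LinearMap.add_apply, LinearMap.smul_apply, map_add, map_smul, smul_eq_mul, hFF, hGG, h]
  ring

theorem poissonBracket_of_left_eq_zero
    (h : (differential F x : Module.Dual ℝ (TangentSpace 𝓘(ℝ, E) x)) = 0) :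
    Ω.poissonBracket F G x = 0 := by
  rw [poissonBracket, h]
  rfl

theorem poissonBracket_of_right_eq_zero
    (h : (differential G x : Module.Dual ℝ (TangentSpace 𝓘(ℝ, E) x)) = 0) :
    Ω.poissonBracket F G x = 0 := by
  rw [poissonBracket_antisymm, poissonBracket_of_left_eq_zero Ω h, neg_zero]

/-- The Jacobian of `(x, y) ↦ (ρ x, σ y)` is a product of two slopes in `[0, 1]`. -/
theorem abs_poissonBracket_comp_le {ρ σ : ℝ → ℝ} (hF : IsSmoothCompactSupport E F)
    (hG : IsSmoothCompactSupport E G) (hρ : ∃ k ∈ Icc (0 : ℝ) 1, HasDerivAt ρ k (F x))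
    (hσ : ∃ k ∈ Icc (0 : ℝ) 1, HasDerivAt σ k (G x)) :
    |Ω.poissonBracket (fun x => ρ (F x)) (fun x => σ (G x)) x| ≤ |Ω.poissonBracket F G x| := by
  obtain ⟨k, hk, h⟩ := hρ
  obtain ⟨l, hl, h'⟩ := hσ
  rw [Ω.poissonBracket_eq_det_mul (F := F) (G := G) (p := k) (q := 0) (r := 0) (s := l)
    (by simp [differential_comp hF h]) (by simp [differential_comp hG h']), abs_mul]
  refine mul_le_of_le_one_left (abs_nonneg _) ?_
  rw [zero_mul, sub_zero, abs_of_nonneg (mul_nonneg hk.1 hl.1)]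
  exact mul_le_one₀ hk.2 hl.1 hl.2

end SymplecticForm

end functions

/-! ### Comparison of suprema -/

theorem supNorm_le_mul {α : Type*} {f g : α → ℝ} {C : ℝ} (hC : 0 ≤ C)
    (h : ∀ x, |f x| ≤ C * |g x|) : supNorm f ≤ ENNReal.ofReal C * supNorm g := by
  refine iSup_le fun x => ?_
  calc ‖f x‖ₑ = ENNReal.ofReal |f x| := by rw [← Real.norm_eq_abs, ofReal_norm]
    _ ≤ ENNReal.ofReal (C * |g x|) := ENNReal.ofReal_le_ofReal (h x)
    _ = ENNReal.ofReal C * ‖g x‖ₑ := by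
      rw [ENNReal.ofReal_mul hC, ← Real.norm_eq_abs, ofReal_norm]
    _ ≤ _ := mul_le_mul_right (le_iSup (fun x => ‖g x‖ₑ) x) _

theorem le_of_forall_le_inv_sq_mul {a b : ℝ≥0∞} {C : ℝ} (hC : 0 < C)
    (h : ∀ c ∈ Ioo (0 : ℝ) 1, a ≤ ENNReal.ofReal (C * (c⁻¹) ^ 2) * b) :
    a ≤ ENNReal.ofReal C * b := by
  have h₁ : Tendsto (fun c : ℝ => C * (c⁻¹) ^ 2) (𝓝[<] 1) (𝓝 C) := by
    have : ContinuousAt (fun c : ℝ => C * (c⁻¹) ^ 2) 1 :=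
      continuousAt_const.mul ((continuousAt_inv₀ one_ne_zero).pow 2)
    simpa [ContinuousAt] using this.tendsto.mono_left nhdsWithin_le_nhds
  -- The limit factor is nonzero, so `b = ∞` is allowed.
  have h₂ := ENNReal.Tendsto.mul_const (b := b) (ENNReal.tendsto_ofReal h₁)
    (Or.inl (ENNReal.ofReal_pos.2 hC).ne')
  exact ge_of_tendsto h₂ (mem_of_superset (Ioo_mem_nhdsLT one_pos) h)

/-! ### The two inequalities -/

section inequalities

variable {E : Type*} [NormedAddCommGroup E] [NormedSpace ℝ E] [FiniteDimensional ℝ E]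
  {M : Type*} [TopologicalSpace M] [ChartedSpace E M] (Ω : SymplecticForm E M)
  {X₀ X₁ Y₀ Y₁ : Set M} {F G : M → ℝ}

theorem pb₃_le {X Y Z : Set M} (hF : IsSmoothCompactSupport E F) (hG : IsSmoothCompactSupport E G)
    (hX : ∀ x ∈ X, F x ≤ 0) (hY : ∀ x ∈ Y, G x ≤ 0) (hZ : ∀ x ∈ Z, 1 ≤ F x + G x) :
    pb₃ Ω X Y Z ≤ supNorm (Ω.poissonBracket F G) :=
  sInf_le ⟨F, G, hF, hG, hX, hY, hZ, rfl⟩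

theorem pb₄_le (hF : IsSmoothCompactSupport E F) (hG : IsSmoothCompactSupport E G)
    (hX₀ : ∀ x ∈ X₀, F x ≤ 0) (hX₁ : ∀ x ∈ X₁, 1 ≤ F x)
    (hY₀ : ∀ x ∈ Y₀, G x ≤ 0) (hY₁ : ∀ x ∈ Y₁, 1 ≤ G x) :
    pb₄ Ω X₀ X₁ Y₀ Y₁ ≤ supNorm (Ω.poissonBracket F G) :=
  sInf_le ⟨F, G, hF, hG, hX₀, hX₁, hY₀, hY₁, rfl⟩

/-- An admissible pair for `pb₄` is turned into one for `pb₃` by the map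
`(x, y) ↦ (x - min x y / 2, y - min x y / 2)`, smoothened, of Jacobian `1 / 2`. -/
theorem pb₃_le_of_admissible (hF : IsSmoothCompactSupport E F) (hG : IsSmoothCompactSupport E G)
    (hFX₀ : ∀ x ∈ X₀, F x ≤ 0) (hFX₁ : ∀ x ∈ X₁, 1 ≤ F x)
    (hGY₀ : ∀ x ∈ Y₀, G x ≤ 0) (hGY₁ : ∀ x ∈ Y₁, 1 ≤ G x) {c : ℝ} (hc : c ∈ Ioo (0 : ℝ) 1) :
    pb₃ Ω X₀ Y₀ (X₁ ∪ Y₁) ≤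
      ENNReal.ofReal (1 / 2 * (c⁻¹) ^ 2) * supNorm (Ω.poissonBracket F G) := by
  obtain ⟨hc0, hc1⟩ := hc
  -- Two nested smoothings lose at most `2 * ε = 1 - c`.
  set ε := (1 - c) / 2 with hε_def
  have hε : 0 < ε := by rw [hε_def]; linarith
  set χ := smoothPosPart ε
  have hχ : ContDiff ℝ ∞ χ := contDiff_smoothPosPart ε
  have hχ0 : χ 0 = 0 := smoothPosPart_of_nonpos hε le_rfl
  set P : M → ℝ := fun x => χ (F x)
  set Q : M → ℝ := fun x => χ (G x)
  have hP : IsSmoothCompactSupport E P := hF.comp hχ hχ0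
  have hQ : IsSmoothCompactSupport E Q := hG.comp hχ hχ0
  have hP0 : ∀ x, 0 ≤ P x := fun x => smoothPosPart_nonneg hε _
  have hQ0 : ∀ x, 0 ≤ Q x := fun x => smoothPosPart_nonneg hε _
  set d : M → ℝ := fun x => 1 * P x + (-1) * Q x with hd_def
  have hd : IsSmoothCompactSupport E d := hP.linearComb hQ _ _
  -- `K` stands for `(P - Q)⁺`, hence `P - K` for `min P Q` and `Q + K` for `max P Q`.
  set K : M → ℝ := fun x => χ (d x) with hK_def
  have hK : IsSmoothCompactSupport E K := hd.comp hχ hχ0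
  have hK0 : ∀ x, 0 ≤ K x := fun x => smoothPosPart_nonneg hε _
  have hR := hP.linearComb hK (-1) 1
  refine (pb₃_le Ω (hP.linearComb hK (c⁻¹ / 2) (c⁻¹ / 2))
    (hQ.linearComb hR c⁻¹ (c⁻¹ / 2)) (fun x hx => ?_) (fun x hx => ?_) (fun x hx => ?_)).trans
    (supNorm_le_mul (by positivity) fun x => ?_)
  · have h₁ : P x = 0 := smoothPosPart_of_nonpos hε (hFX₀ x hx)
    have h₂ : K x = 0 := smoothPosPart_of_nonpos hε (by simp only [hd_def]; linarith [hQ0 x])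
    simp [h₁, h₂]
  · have h₁ : Q x = 0 := smoothPosPart_of_nonpos hε (hGY₀ x hx)
    have h₂ : d x = P x := by simp [hd_def, h₁]
    have h₃ : K x ≤ P x := by
      rw [← h₂]
      exact smoothPosPart_le hε (by rw [h₂]; exact hP0 x)
    rw [h₁, mul_zero, zero_add]
    exact mul_nonpos_of_nonneg_of_nonpos (by positivity) (by linarith)
  · have h₁ : c ≤ Q x + K x := by
      rcases hx with hx | hx
      · have h₁ : F x - ε ≤ P x := sub_le_smoothPosPart hε _
        have h₂ : d x - ε ≤ K x := sub_le_smoothPosPart hε _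
        have h₃ := hFX₁ x hx
        simp only [hd_def] at h₂
        linarith
      · have h₁ : G x - ε ≤ Q x := sub_le_smoothPosPart hε _
        have h₃ := hGY₁ x hx
        linarith [hK0 x]
    calc (1 : ℝ) = c⁻¹ * c := (inv_mul_cancel₀ hc0.ne').symm
      _ ≤ c⁻¹ * (Q x + K x) := mul_le_mul_of_nonneg_left h₁ (by positivity)
      _ = _ := by ring
  · obtain ⟨k, -, hk⟩ := exists_hasDerivAt_smoothPosPart hε (d x)
    have hdK : (differential K x : Module.Dual ℝ (TangentSpace 𝓘(ℝ, E) x)) =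
        k • differential P x + (-k) • differential Q x := by
      rw [hK_def, differential_comp hd hk, differential_linearComb hP hQ]
      module
    rw [Ω.poissonBracket_eq_det_mul (F := P) (G := Q)
      (p := c⁻¹ / 2 * (1 + k)) (q := - (c⁻¹ / 2 * k))
      (r := c⁻¹ / 2 * (k - 1)) (s := c⁻¹ / 2 * (2 - k)), abs_mul]
    -- The slope `k` cancels: the difference of the new functions is `c⁻¹ * (P - Q)` and `K` depends
    -- on `P - Q` only, so the smoothing is a shear.
    · have h : c⁻¹ / 2 * (1 + k) * (c⁻¹ / 2 * (2 - k)) - -(c⁻¹ / 2 * k) * (c⁻¹ / 2 * (k - 1)) =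
          1 / 2 * (c⁻¹) ^ 2 := by ring
      rw [h, abs_of_nonneg (by positivity)]
      exact mul_le_mul_of_nonneg_left (Ω.abs_poissonBracket_comp_le hF hG
        (exists_hasDerivAt_smoothPosPart hε _) (exists_hasDerivAt_smoothPosPart hε _))
        (by positivity)
    · rw [differential_linearComb hP hK, hdK]
      module
    · rw [differential_linearComb hQ hR, differential_linearComb hP hK, hdK]
      module

/-- An admissible pair for `pb₃` is turned into one for `pb₄` by the map
`(u, v) ↦ (u + min u v, v + min u v)`, smoothened and clipped, of Jacobian at most `2`, followed by
the addition of cutoff functions to each function in regions where the other one is constant. -/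
theorem pb₄_le_of_admissible [IsManifold 𝓘(ℝ, E) ∞ M] [T2Space M] [SigmaCompactSpace M]
    (hX₀ : IsCompact X₀) (hX₁ : IsCompact X₁) (hY₀ : IsCompact Y₀) (hY₁ : IsCompact Y₁)
    (hX : X₀ ∩ X₁ = ∅) (hY : Y₀ ∩ Y₁ = ∅)
    (hF : IsSmoothCompactSupport E F) (hG : IsSmoothCompactSupport E G)
    (hFX₀ : ∀ x ∈ X₀, F x ≤ 0) (hGY₀ : ∀ x ∈ Y₀, G x ≤ 0)
    (hFG : ∀ x ∈ X₁ ∪ Y₁, 1 ≤ F x + G x) {c : ℝ} (hc : c ∈ Ioo (0 : ℝ) 1) :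
    pb₄ Ω X₀ X₁ Y₀ Y₁ ≤
      ENNReal.ofReal (2 * (c⁻¹) ^ 2) * supNorm (Ω.poissonBracket F G) := by
  obtain ⟨hc0, hc1⟩ := hc
  -- Clipping at `1 - 2 * ε` yields the constant `C ≥ 1 - 5 * ε = c`.
  set ε := (1 - c) / 5 with hε_def
  have hε : 0 < ε := by rw [hε_def]; linarith
  set χ := smoothPosPart ε
  have hχ : ContDiff ℝ ∞ χ := contDiff_smoothPosPart ε
  have hχ0 : χ 0 = 0 := smoothPosPart_of_nonpos hε le_rfl
  set d : M → ℝ := fun x => 1 * F x + (-1) * G x with hd_def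
  have hd : IsSmoothCompactSupport E d := hF.linearComb hG _ _
  set K : M → ℝ := fun x => χ (d x) with hK_def
  have hK : IsSmoothCompactSupport E K := hd.comp hχ hχ0
  have hS := hF.linearComb hG 1 1
  set P : M → ℝ := fun x => 2 * F x + (-1) * K x with hP_def
  set Q : M → ℝ := fun x => 1 * (1 * F x + 1 * G x) + (-1) * K x with hQ_def
  have hP : IsSmoothCompactSupport E P := hF.linearComb hK _ _
  have hQ : IsSmoothCompactSupport E Q := hS.linearComb hK _ _
  have hPc : Continuous P := hP.1.continuous
  have hQc : Continuous Q := hQ.1.continuous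
  have hPX₀ : ∀ x ∈ X₀, P x ≤ ε := fun x hx => by
    have h : 0 ≤ K x := smoothPosPart_nonneg hε _
    simp only [hP_def]
    linarith [hFX₀ x hx]
  have hQY₀ : ∀ x ∈ Y₀, Q x ≤ ε := fun x hx => by
    have h : d x - ε ≤ K x := sub_le_smoothPosPart hε _
    simp only [hd_def] at h
    simp only [hQ_def]
    linarith [hGY₀ x hx]
  have hPQ : ∀ x ∈ X₁ ∪ Y₁, 1 ≤ P x ∨ 1 ≤ Q x := fun x hx => by
    have h := hFG x hx
    rcases le_total 0 (d x) with h' | h'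
    · left
      have h₁ : K x ≤ d x := smoothPosPart_le hε h'
      simp only [hd_def] at h₁
      simp only [hP_def]
      linarith
    · right
      have h₁ : K x = 0 := smoothPosPart_of_nonpos hε h'
      simp only [hQ_def, h₁]
      linarith
  have hbracket : ∀ x, Ω.poissonBracket P Q x = 2 * Ω.poissonBracket F G x := fun x => by
    obtain ⟨k, -, hk⟩ := exists_hasDerivAt_smoothPosPart hε (d x)
    have hdK : (differential K x : Module.Dual ℝ (TangentSpace 𝓘(ℝ, E) x)) =
        k • differential F x + (-k) • differential G x := by
      rw [hK_def, differential_comp hd hk, differential_linearComb hF hG]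
      module
    rw [Ω.poissonBracket_eq_det_mul (F := F) (G := G)
      (p := 2 - k) (q := k) (r := 1 - k) (s := 1 + k)]
    · ring
    · rw [differential_linearComb hF hK, hdK]
      module
    · rw [differential_linearComb hS hK, differential_linearComb hF hG, hdK]
      module
  obtain ⟨ρ, C, hρ, hρ0, hρ_nonneg, hρC, hC, hρ'⟩ :=
    exists_smooth_clip hε (1 - 2 * ε)
  replace hC : c ≤ C := by linarith
  have hρP := hP.comp hρ (hρ0 0 hε.le)
  have hρQ := hQ.comp hρ (hρ0 0 hε.le)
  -- On `U` the clipped `Q` is locally constant, on `V` the clipped `P`. The shared threshold `1 -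
  -- ε` makes them disjoint, and lying strictly above `1 - 2 * ε` it leaves room for the cutoffs.
  set U : Set M := {x | 1 - ε < Q x ∧ P x < 1 - ε}
  set V : Set M := {x | 1 - ε < P x ∧ Q x < 1 - ε}
  have hUo : IsOpen U :=
    (isOpen_lt continuous_const hQc).inter (isOpen_lt hPc continuous_const)
  have hVo : IsOpen V :=
    (isOpen_lt continuous_const hPc).inter (isOpen_lt hQc continuous_const)
  have hUV : ∀ x ∈ U, x ∉ V := fun x h h' => lt_asymm h.2 h'.1
  obtain ⟨α, hα, hα0, hα1, hαU⟩ := exists_cutoff (E := E)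
    (hX₁.inter_right (isClosed_le hPc (continuous_const (y := 1 - 2 * ε))))
    (hUo.inter hX₀.isClosed.isOpen_compl) fun x ⟨hx, (hx' : P x ≤ 1 - 2 * ε)⟩ => by
      refine ⟨⟨?_, by linarith⟩, fun h => (hX ▸ ⟨h, hx⟩ : x ∈ (∅ : Set M))⟩
      rcases hPQ x (Or.inl hx) with h | h <;> linarith
  obtain ⟨β, hβ, hβ0, hβ1, hβV⟩ := exists_cutoff (E := E)
    (hY₁.inter_right (isClosed_le hQc (continuous_const (y := 1 - 2 * ε))))
    (hVo.inter hY₀.isClosed.isOpen_compl) fun x ⟨hx, (hx' : Q x ≤ 1 - 2 * ε)⟩ => by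
      refine ⟨⟨?_, by linarith⟩, fun h => (hY ▸ ⟨h, hx⟩ : x ∈ (∅ : Set M))⟩
      rcases hPQ x (Or.inr hx) with h | h <;> linarith
  have hdα : ∀ x ∉ U, (differential α x : Module.Dual ℝ (TangentSpace 𝓘(ℝ, E) x)) = 0 :=
    fun x hx => differential_eq_zero_of_eventually_eq
      (notMem_tsupport_iff_eventuallyEq.1 fun h => hx (hαU h).1)
  have hdβ : ∀ x ∉ V, (differential β x : Module.Dual ℝ (TangentSpace 𝓘(ℝ, E) x)) = 0 :=
    fun x hx => differential_eq_zero_of_eventually_eq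
      (notMem_tsupport_iff_eventuallyEq.1 fun h => hx (hβV h).1)
  have hone : ∀ t, 1 - 2 * ε ≤ t → 1 ≤ c⁻¹ * ρ t := fun t ht => by
    rw [hρC t ht]
    calc (1 : ℝ) = c⁻¹ * c := (inv_mul_cancel₀ hc0.ne').symm
      _ ≤ c⁻¹ * C := mul_le_mul_of_nonneg_left hC (by positivity)
  have hnonneg : ∀ t, 0 ≤ c⁻¹ * ρ t := fun t => mul_nonneg (by positivity) (hρ_nonneg t)
  refine (pb₄_le Ω (hρP.linearComb hα c⁻¹ 1) (hρQ.linearComb hβ c⁻¹ 1) (fun x hx => ?_)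
    (fun x hx => ?_) (fun x hx => ?_) (fun x hx => ?_)).trans
    (supNorm_le_mul (by positivity) fun x => ?_)
  · have h : α x = 0 := image_eq_zero_of_notMem_tsupport fun h => (hαU h).2 hx
    simp [h, hρ0 _ (hPX₀ x hx)]
  · rcases le_total (P x) (1 - 2 * ε) with h | h
    · linarith [hα1 x ⟨hx, h⟩, hnonneg (P x)]
    · linarith [hα0 x, hone _ h]
  · have h : β x = 0 := image_eq_zero_of_notMem_tsupport fun h => (hβV h).2 hx
    simp [h, hρ0 _ (hQY₀ x hx)]
  · rcases le_total (Q x) (1 - 2 * ε) with h | h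
    · linarith [hβ1 x ⟨hx, h⟩, hnonneg (Q x)]
    · linarith [hβ0 x, hone _ h]
  -- On `U` the second function has zero differential, on `V` the first; elsewhere neither cutoff
  -- contributes and only the clipped pair remains.
  · have hbound : 0 ≤ 2 * (c⁻¹) ^ 2 * |Ω.poissonBracket F G x| := by positivity
    by_cases hxU : x ∈ U
    · rw [Ω.poissonBracket_of_right_eq_zero, abs_zero]
      · exact hbound
      · rw [differential_linearComb hρQ hβ, hdβ x (hUV x hxU),
          differential_eq_zero_of_eventually_eq (c := C)]
        · simp
        · filter_upwards [hUo.mem_nhds hxU] with y hy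
          exact hρC _ (by linarith [hy.1])
    · by_cases hxV : x ∈ V
      · rw [Ω.poissonBracket_of_left_eq_zero, abs_zero]
        · exact hbound
        · rw [differential_linearComb hρP hα, hdα x hxU,
            differential_eq_zero_of_eventually_eq (c := C)]
          · simp
          · filter_upwards [hVo.mem_nhds hxV] with y hy
            exact hρC _ (by linarith [hy.1])
      · rw [Ω.poissonBracket_eq_det_mul (F := fun x => ρ (P x)) (G := fun x => ρ (Q x))
          (p := c⁻¹) (q := 0) (r := 0) (s := c⁻¹), abs_mul]
        · have h := Ω.abs_poissonBracket_comp_le (x := x) hP hQ (hρ' _) (hρ' _)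
          rw [hbracket, abs_mul, abs_two] at h
          rw [zero_mul, sub_zero, ← sq, abs_of_nonneg (by positivity)]
          calc _ ≤ (c⁻¹) ^ 2 * (2 * |Ω.poissonBracket F G x|) :=
                mul_le_mul_of_nonneg_left h (by positivity)
            _ = _ := by ring
        · rw [differential_linearComb hρP hα, hdα x hxU]
          simp
        · rw [differential_linearComb hρQ hβ, hdβ x hxV]
          simp

end inequalities

end PoissonBracketInvariants

theorem mainTheorem1
    {E : Type*} [NormedAddCommGroup E] [NormedSpace ℝ E] [FiniteDimensional ℝ E]
    {M : Type*} [TopologicalSpace M] [ChartedSpace E M] [IsManifold 𝓘(ℝ, E) ∞ M]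
    [T2Space M] [SigmaCompactSpace M]
    (Ω : PoissonBracketInvariants.SymplecticForm E M)
    (X₀ X₁ Y₀ Y₁ : Set M)
    (hX₀ : IsCompact X₀) (hX₁ : IsCompact X₁) (hY₀ : IsCompact Y₀) (hY₁ : IsCompact Y₁)
    (hX : X₀ ∩ X₁ = ∅) (hY : Y₀ ∩ Y₁ = ∅) :
    PoissonBracketInvariants.pb₄ Ω X₀ X₁ Y₀ Y₁ =
      2 * PoissonBracketInvariants.pb₃ Ω X₀ Y₀ (X₁ ∪ Y₁) := by
  have htwo : ENNReal.ofReal 2 = 2 := by simp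
  have hhalf : ENNReal.ofReal (1 / 2) = 2⁻¹ := by
    rw [one_div, ENNReal.ofReal_inv_of_pos two_pos, htwo]
  apply le_antisymm
  · rw [mul_comm, ← ENNReal.div_le_iff_le_mul (by simp) (by simp)]
    refine le_sInf ?_
    rintro _ ⟨F, G, hF, hG, hFX₀, hGY₀, hFG, rfl⟩
    rw [ENNReal.div_le_iff_le_mul (by simp) (by simp), mul_comm, ← htwo]
    exact PoissonBracketInvariants.le_of_forall_le_inv_sq_mul two_pos fun c hc =>
      PoissonBracketInvariants.pb₄_le_of_admissible Ω hX₀ hX₁ hY₀ hY₁ hX hY hF hG hFX₀ hGY₀ hFG hc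
  · refine le_sInf ?_
    rintro _ ⟨F, G, hF, hG, hFX₀, hFX₁, hGY₀, hGY₁, rfl⟩
    rw [mul_comm, ← ENNReal.le_div_iff_mul_le (by simp) (by simp), div_eq_mul_inv, mul_comm,
      ← hhalf]
    exact PoissonBracketInvariants.le_of_forall_le_inv_sq_mul (by norm_num) fun c hc =>
      PoissonBracketInvariants.pb₃_le_of_admissible Ω hF hG hFX₀ hFX₁ hGY₀ hGY₁ hc
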